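/- Let $N$ be a finite set (for instance $N=\{1,\dots,n\}$). For $f:\mathbb{Z}^N\to\mathbb{R}\cup\{+\infty,-\infty\}$ let $\operatorname{dom} f=\{x\in\mathbb{Z}^N : f(x)<+\infty\}$, and for $i\in N$ let $\mathbf{1}^i$ denote the $i$-th unit vector. For $x,y\in\mathbb{Z}^N$, an $(x,y)$-increment is a vector $s=\pm\mathbf{1}^i$, for some $i\in N$, such that $x\wedge y\le x+s\le x\vee y$, where $\wedge$ and $\vee$ are the componentwise minimum and maximum. A function $f$ is called jump M$^\natural$-convex if it never takes the value $-\infty$, $\operatorname{dom} f\ne\emptyset$, and for all $x,y\in\operatorname{dom} f$ and every $(x,y)$-increment $s$ at least one of the following holds: (i) $x+s\in\operatorname{dom} f$, $y-s\in\operatorname{dom} f$, and $f(x)+f(y)\ge f(x+s)+f(y-s)$; (ii) there exists an $(x+s,y)$-increment $t$ such that $x+s+t\in\operatorname{dom} f$, $y-s-t\in\operatorname{dom} f$, and $f(x)+f(y)\ge f(x+s+t)+f(y-s-t)$. For $U\subseteq N$, $y\in\mathbb{Z}^U$ and $z\in\mathbb{Z}^{N\setminus U}$, let $(y,z)\in\mathbb{Z}^N$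 be the vector whose $i$-th component is $y_i$ for $i\in U$ and $z_i$ for $i\in N\setminus U$. The restriction $f_U$ and the projection $f^U$ of $f$ to $U$ are the functions on $\mathbb{Z}^U$ given by $$f_U(y)=f(y,\mathbf{0}),\qquad f^U(y)=\inf\{f(y,z) : z\in\mathbb{Z}^{N\setminus U}\},$$ where $\mathbf{0}$ is the zero vector of $\mathbb{Z}^{N\setminus U}$ and $f^U$ may take the value $-\infty$. **Proposition 4.3.** Let $f:\mathbb{Z}^N\to\mathbb{R}\cup\{+\infty\}$ be a jump M$^\natural$-convex function and let $U\subseteq N$. (1) If $\operatorname{dom} f_U\neq\emptyset$, then the restriction $f_U$ is jump M$^\natural$-convex. (2) If $f^U(y)>-\infty$ for all $y\in\mathbb{Z}^U$, then the projection $f^U$ is jump M$^\natural$-convex. -/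

import Mathlib

namespace JumpMnat

/-- The effective domain of `f`: the points at which `f` is less than `+∞`. -/
def dom {N : Type*} (f : (N → ℤ) → EReal) : Set (N → ℤ) :=
  {x | f x < ⊤}

/-- `s` is an `(x, y)`-increment: plus or minus a unit vector such that `x + s` lies in the
smallest integer box containing `x` and `y`. -/
def IsIncrement {N : Type*} [DecidableEq N] (x y s : N → ℤ) : Prop :=
  (∃ i : N, s = Pi.single i 1 ∨ s = -Pi.single i 1) ∧ x + s ∈ Set.Icc (x ⊓ y) (x ⊔ y)

/-- The exchange axiom: for all `x, y ∈ dom f` and every `(x, y)`-increment `s`, either `s` alone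
can be exchanged, or `s + t` can be exchanged for some `(x + s, y)`-increment `t`. -/
def Exchange {N : Type*} [DecidableEq N] (f : (N → ℤ) → EReal) : Prop :=
  ∀ x ∈ dom f, ∀ y ∈ dom f, ∀ s : N → ℤ, IsIncrement x y s →
    (x + s ∈ dom f ∧ y - s ∈ dom f ∧ f x + f y ≥ f (x + s) + f (y - s)) ∨
    (∃ t : N → ℤ, IsIncrement (x + s) y t ∧
      x + s + t ∈ dom f ∧ y - s - t ∈ dom f ∧
      f x + f y ≥ f (x + s + t) + f (y - s - t))

/-- `f` is jump M-natural-convex: `f` takes values in `ℝ ∪ {+∞}`, its effective domain is nonempty,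
and it satisfies the exchange axiom. -/
structure IsJumpMnatConvex {N : Type*} [DecidableEq N] (f : (N → ℤ) → EReal) : Prop where
  bot_lt : ∀ x, ⊥ < f x
  dom_nonempty : (dom f).Nonempty
  exchange : Exchange f

/-- The vector `(y, z)` whose `i`-th component is `y i` for `i ∈ U` and `z i` for `i ∉ U`. -/
def combine {N : Type*} [DecidableEq N] (U : Finset N)
    (y : {i // i ∈ U} → ℤ) (z : {i // i ∉ U} → ℤ) : N → ℤ :=
  fun i => if h : i ∈ U then y ⟨i, h⟩ else z ⟨i, h⟩

/-- The restriction `f_U` of `f` to `U`: the coordinates outside `U` are set to zero. -/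
def restriction {N : Type*} [DecidableEq N] (f : (N → ℤ) → EReal) (U : Finset N) :
    ({i // i ∈ U} → ℤ) → EReal :=
  fun y => f (combine U y 0)

/-- The projection (partial minimization) `f^U` of `f` to `U`. The infimum is taken in the
extended reals, so the value may be `-∞`. -/
noncomputable def projection {N : Type*} [DecidableEq N] (f : (N → ℤ) → EReal) (U : Finset N) :
    ({i // i ∈ U} → ℤ) → EReal :=
  fun y => ⨅ z : {i // i ∉ U} → ℤ, f (combine U y z)

end JumpMnat

/-! Increments on `U` are extended by zero, exchanged in `f`, and the answer is read back on `U`.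
For the restriction, both vectors vanish off `U`, hence so does the second increment. For the
projection, a second increment off `U` becomes zero, so (ii) turns into (i). The infima need not be
attained and the exchange depends on the near-minimizers; but there are only finitely many candidate
increments, so a single best one serves all approximations. -/

namespace JumpMnat

section Aux

variable {N : Type*} {U : Finset N}

/-- The coordinates of a vector in `U`. -/
def coords (U : Finset N) (v : N → ℤ) : {i // i ∈ U} → ℤ := fun i => v i

@[simp]
theorem coords_add (v w : N → ℤ) : coords U (v + w) = coords U v + coords U w := rfl

@[simp]
theorem coords_sub (v w : N → ℤ) : coords U (v - w) = coords U v - coords U w := rfl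

variable [DecidableEq N]

theorem combine_of_mem (y : {i // i ∈ U} → ℤ) (z : {i // i ∉ U} → ℤ) {i : N} (h : i ∈ U) :
    combine U y z i = y ⟨i, h⟩ := dif_pos h

theorem combine_of_notMem (y : {i // i ∈ U} → ℤ) (z : {i // i ∉ U} → ℤ) {i : N} (h : i ∉ U) :
    combine U y z i = z ⟨i, h⟩ := dif_neg h

@[simp]
theorem coords_combine (y : {i // i ∈ U} → ℤ) (z : {i // i ∉ U} → ℤ) :
    coords U (combine U y z) = y :=
  funext fun i => combine_of_mem y z i.2

theorem combine_coords (v : N → ℤ) : combine U (coords U v) (fun i => v i) = v := by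
  funext i
  by_cases h : i ∈ U
  · rw [combine_of_mem _ _ h, coords]
  · rw [combine_of_notMem _ _ h]

theorem combine_coords_zero {v : N → ℤ} (hv : ∀ i ∉ U, v i = 0) :
    combine U (coords U v) 0 = v := by
  funext i
  by_cases h : i ∈ U
  · rw [combine_of_mem _ _ h, coords]
  · rw [combine_of_notMem _ _ h, hv i h, Pi.zero_apply]

theorem combine_add (x s : {i // i ∈ U} → ℤ) (z w : {i // i ∉ U} → ℤ) :
    combine U x z + combine U s w = combine U (x + s) (z + w) := by
  funext i
  by_cases h : i ∈ U <;> simp [combine, h]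

theorem combine_sub (x s : {i // i ∈ U} → ℤ) (z w : {i // i ∉ U} → ℤ) :
    combine U x z - combine U s w = combine U (x - s) (z - w) := by
  funext i
  by_cases h : i ∈ U <;> simp [combine, h]

theorem combine_single (i : {i // i ∈ U}) (a : ℤ) :
    combine U (Pi.single i a) 0 = Pi.single (i : N) a := by
  funext j
  by_cases h : j ∈ U
  · rw [combine_of_mem _ _ h, Pi.single_apply, Pi.single_apply]
    simp [Subtype.ext_iff]
  · rw [combine_of_notMem _ _ h, Pi.single_eq_of_ne (fun hj : j = i => h (hj ▸ i.2)), Pi.zero_apply]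

theorem IsIncrement.combine {x y s : {i // i ∈ U} → ℤ} (h : IsIncrement x y s)
    (z w : {i // i ∉ U} → ℤ) :
    IsIncrement (combine U x z) (combine U y w) (combine U s 0) := by
  obtain ⟨⟨i, hi⟩, hl, hu⟩ := h
  refine ⟨⟨i, ?_⟩, ?_, ?_⟩
  · simp only [← Pi.single_neg] at hi ⊢
    rcases hi with rfl | rfl <;> simp [combine_single]
  · intro j
    rw [combine_add]
    by_cases hj : j ∈ U
    · simpa [JumpMnat.combine, hj] using hl ⟨j, hj⟩
    · simp [JumpMnat.combine, hj]
  · intro j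
    rw [combine_add]
    by_cases hj : j ∈ U
    · simpa [JumpMnat.combine, hj] using hu ⟨j, hj⟩
    · simp [JumpMnat.combine, hj]

theorem IsIncrement.ne_zero {x y s : N → ℤ} (h : IsIncrement x y s) : s ≠ 0 := by
  obtain ⟨⟨i, rfl | rfl⟩, -⟩ := h <;> simp

theorem IsIncrement.coords {x y t : N → ℤ} (h : IsIncrement x y t) :
    coords U t = 0 ∨ IsIncrement (coords U x) (coords U y) (coords U t) := by
  obtain ⟨⟨i, hi⟩, hl, hu⟩ := h
  simp only [← Pi.single_neg] at hi
  by_cases hU : i ∈ U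
  · refine Or.inr ⟨⟨⟨i, hU⟩, ?_⟩, fun j => hl j, fun j => hu j⟩
    simp only [← Pi.single_neg]
    exact hi.imp (fun h => by rw [h, ← combine_single ⟨i, hU⟩, coords_combine])
      (fun h => by rw [h, ← combine_single ⟨i, hU⟩, coords_combine])
  · left
    funext j
    have hj : (j : N) ≠ i := fun hj => hU (hj ▸ j.2)
    rcases hi with rfl | rfl <;> simp [JumpMnat.coords, hj]

/-- An increment of two vectors vanishing outside `U` comes from an increment in `ℤ^U`. -/
theorem IsIncrement.exists_of_combine_zero {x y : {i // i ∈ U} → ℤ} {t : N → ℤ}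
    (h : IsIncrement (JumpMnat.combine U x 0) (JumpMnat.combine U y 0) t) :
    ∃ t', IsIncrement x y t' ∧ t = JumpMnat.combine U t' 0 := by
  have ht : JumpMnat.combine U (JumpMnat.coords U t) 0 = t := by
    refine combine_coords_zero fun i hi => ?_
    have hl := h.2.1 i
    have hu := h.2.2 i
    simp only [Pi.inf_apply, Pi.sup_apply, Pi.add_apply, combine_of_notMem _ _ hi,
      Pi.zero_apply, zero_add, inf_idem, sup_idem] at hl hu
    exact le_antisymm hu hl
  refine ⟨JumpMnat.coords U t, ?_, ht.symm⟩
  rcases h.coords (U := U) with h0 | h0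
  · refine absurd ?_ h.ne_zero
    rw [← ht, h0]
    funext i
    simp [JumpMnat.combine]
  · simpa using h0

/-- Translation by `x` is injective and sends increments into a finite integer box. -/
theorem finite_setOf_isIncrement [Finite N] (x y : N → ℤ) : {s | IsIncrement x y s}.Finite := by
  have := Fintype.ofFinite N
  exact ((Set.finite_Icc (x ⊓ y) (x ⊔ y)).preimage (add_right_injective x).injOn).subset
    fun s hs => hs.2

theorem isJumpMnatConvex_restriction {f : (N → ℤ) → EReal} (hf : IsJumpMnatConvex f)
    (hU : (dom (restriction f U)).Nonempty) : IsJumpMnatConvex (restriction f U) := by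
  refine ⟨fun y => hf.bot_lt _, hU, fun x hx y hy s hs => ?_⟩
  rcases hf.exchange _ hx _ hy _ (hs.combine 0 0) with h | ⟨t, ht, h⟩
  · left
    simp only [combine_add, combine_sub, add_zero, sub_zero] at h
    exact h
  · right
    rw [combine_add, add_zero] at ht
    obtain ⟨t, ht', rfl⟩ := ht.exists_of_combine_zero
    simp only [combine_add, combine_sub, add_zero, sub_zero] at h
    exact ⟨t, ht', h⟩

theorem projection_coords_le (f : (N → ℤ) → EReal) (v : N → ℤ) :
    projection f U (coords U v) ≤ f v :=
  (iInf_le _ _).trans_eq (congrArg f (combine_coords v))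

theorem isJumpMnatConvex_projection [Finite N] {f : (N → ℤ) → EReal} (hf : IsJumpMnatConvex f)
    (hU : ∀ y, ⊥ < projection f U y) : IsJumpMnatConvex (projection f U) := by
  refine ⟨hU, ?_, fun x hx y hy s hs => ?_⟩
  · obtain ⟨v, hv⟩ := hf.dom_nonempty
    exact ⟨coords U v, (projection_coords_le f v).trans_lt hv⟩
  -- The element `0` encodes alternative (i), so both alternatives compete in one minimization of
  -- `h`.
  let T : Set ({i // i ∈ U} → ℤ) := insert 0 {t | IsIncrement (x + s) y t}
  let h : ({i // i ∈ U} → ℤ) → EReal := fun t =>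
    projection f U (x + s + t) + projection f U (y - s - t)
  have hT : T.Finite := (finite_setOf_isIncrement _ _).insert 0
  obtain ⟨t, htT, hmin⟩ := hT.exists_minimalFor h T ⟨0, Set.mem_insert _ _⟩
  have hmin' : ∀ u ∈ T, h t ≤ h u := fun u hu => (le_total (h t) (h u)).elim id (hmin hu)
  -- `t` is fixed before the bounds `a`, `b` above the two infima, so it does not depend on the
  -- approximation.
  have key : h t ≤ projection f U x + projection f U y := by
    refine EReal.le_add_of_forall_gt (Or.inl (hU x).ne') (Or.inr (hU y).ne') ?_
    intro a ha b hb
    obtain ⟨z, hz⟩ := iInf_lt_iff.1 ha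
    obtain ⟨w, hw⟩ := iInf_lt_iff.1 hb
    have hzw : f (combine U x z) + f (combine U y w) ≤ a + b := add_le_add hz.le hw.le
    suffices ∃ u ∈ T, h u ≤ f (combine U x z) + f (combine U y w) by
      obtain ⟨u, hu, hle⟩ := this
      exact (hmin' u hu).trans (hle.trans hzw)
    rcases hf.exchange _ (hz.trans_le le_top) _ (hw.trans_le le_top) _ (hs.combine z w) with
      ⟨-, -, hle⟩ | ⟨u, hu, -, -, hle⟩
    · refine ⟨0, Set.mem_insert _ _, le_trans (add_le_add ?_ ?_) hle⟩
      · simpa using projection_coords_le (U := U) f (combine U x z + combine U s 0)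
      · simpa using projection_coords_le (U := U) f (combine U y w - combine U s 0)
    · refine ⟨coords U u, ?_, le_trans (add_le_add ?_ ?_) hle⟩
      · simpa [T] using hu.coords (U := U)
      · simpa using projection_coords_le (U := U) f (combine U x z + combine U s 0 + u)
      · simpa using projection_coords_le (U := U) f (combine U y w - combine U s 0 - u)
  -- Domain membership follows from the inequality: the sum is below `⊤` and neither term is `⊥`, so
  -- neither term is `⊤`.
  have hlt : h t < ⊤ := key.trans_lt (EReal.add_lt_top (ne_of_lt hx) (ne_of_lt hy))
  have h₁ : projection f U (x + s + t) < ⊤ := by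
    refine Ne.lt_top fun htop => hlt.ne ?_
    simp only [h, htop]
    exact EReal.top_add_of_ne_bot (hU _).ne'
  have h₂ : projection f U (y - s - t) < ⊤ := by
    refine Ne.lt_top fun htop => hlt.ne ?_
    simp only [h, htop]
    exact EReal.add_top_of_ne_bot (hU _).ne'
  rcases htT with rfl | ht
  · left
    simp only [h, add_zero, sub_zero] at key h₁ h₂
    exact ⟨h₁, h₂, key⟩
  · exact Or.inr ⟨t, ht, h₁, h₂, key⟩

end Aux

end JumpMnat

theorem proposition4p3 {N : Type*} [Fintype N] [DecidableEq N]
    (f : (N → ℤ) → EReal) (hf : JumpMnat.IsJumpMnatConvex f) (U : Finset N) :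
    ((JumpMnat.dom (JumpMnat.restriction f U)).Nonempty →
      JumpMnat.IsJumpMnatConvex (JumpMnat.restriction f U)) ∧
    ((∀ y, ⊥ < JumpMnat.projection f U y) →
      JumpMnat.IsJumpMnatConvex (JumpMnat.projection f U)) :=
  ⟨JumpMnat.isJumpMnatConvex_restriction hf, JumpMnat.isJumpMnatConvex_projection hf⟩
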